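/- Let $\mathbb K$ be an algebraically closed field of characteristic $0$. Let $(\mathfrak g,\pi)$, $\pi(x,y)=x\cdot y$, be a pre-Lie algebra over $\mathbb K$, i.e. $(x\cdot y)\cdot z-x\cdot(y\cdot z)=(y\cdot x)\cdot z-y\cdot(x\cdot z)$, with commutator $[x,y]=x\cdot y-y\cdot x$. Let $(V;\rho,\mu)$ be a representation of it: $\rho,\mu:\mathfrak g\to\mathfrak{gl}(V)$ are linear, $\rho([x,y])=\rho(x)\rho(y)-\rho(y)\rho(x)$ and $\mu(y)\mu(x)-\mu(x\cdot y)=\mu(y)\rho(x)-\rho(x)\mu(y)$. Let $D:\mathfrak g\to V$ be a derivation, i.e. a linear map with $D(x\cdot y)=\rho(x)D(y)+\mu(y)D(x)$. (No finite-dimensionality is assumed.) Cochains. Put $C^n(\mathfrak g;V)=\mathrm{Hom}(\wedge^{n-1}\mathfrak g\otimes\mathfrak g,V)$ and $$C^n(\mathfrak g,\pi,\rho,\mu)=\mathrm{Hom}(\wedge^{n-1}\mathfrak g\otimes\mathfrak g,\mathfrak g)\oplus\mathrm{Hom}(\wedge^{n-1}\mathfrak g\otimes V,V)\oplus\mathrm{Hom}(\wedge^{n-2}\mathfrak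 g\otimes V\otimes\mathfrak g,V)$$ for $n\ge1$ (the third summand being $0$ for $n=1$), both being $0$ for $n\le 0$, and $C^n(\mathfrak g,\pi,\rho,\mu,D)=C^n(\mathfrak g,\pi,\rho,\mu)\oplus C^{n-1}(\mathfrak g;V)$. Operators. For $\theta\in C^n(\mathfrak g;V)$ let $\mathrm d\theta\in C^{n+1}(\mathfrak g;V)$ be $$\begin{aligned}(\mathrm d\theta)(x_1,\dots,x_{n+1})={}&\sum_{i=1}^n(-1)^{i+1}\big(\rho(x_i)\theta(x_1,\dots,\hat{x_i},\dots,x_{n+1})+\mu(x_{n+1})\theta(x_1,\dots,\hat{x_i},\dots,x_n,x_i)\\&\qquad-\theta(x_1,\dots,\hat{x_i},\dots,x_n,x_i\cdot x_{n+1})\big)\\&+\sum_{1\le i<j\le n}(-1)^{i+j}\theta([x_i,x_j],x_1,\dots,\hat{x_i},\dots,\hat{x_j},\dots,x_{n+1}).\end{aligned}$$ For $f=(f_{\mathfrak g},f_\rho,f_\mu)\in C^n(\mathfrak g,\pi,\rho,\mu)$ let $\partial f=((\partial f)_{\mathfrak g},(\partial f)_\rho,(\partial f)_\mu)\in C^{n+1}(\mathfrak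 g,\pi,\rho,\mu)$, where $(\partial f)_{\mathfrak g}=\mathrm d f_{\mathfrak g}$ for the regular representation ($V=\mathfrak g$, $\rho(x)y=x\cdot y$, $\mu(x)y=y\cdot x$), $$\begin{aligned}(\partial f)_\rho(x_1,\dots,x_n,u)={}&\sum_{i=1}^n(-1)^{i+1}\big(\rho(f_{\mathfrak g}(x_1,\dots,\hat{x_i},\dots,x_n,x_i))u+\rho(x_i)f_\rho(x_1,\dots,\hat{x_i},\dots,x_n,u)\\&\qquad-f_\rho(x_1,\dots,\hat{x_i},\dots,x_n,\rho(x_i)u)\big)\\&+\sum_{1\le i<j\le n}(-1)^{i+j}f_\rho([x_i,x_j],x_1,\dots,\hat{x_i},\dots,\hat{x_j},\dots,x_n,u),\end{aligned}$$ $$\begin{aligned}(\partial f)_\mu(x_1,\dots,&x_{n-1},u,x_n)\\={}&(-1)^{n-1}\big(\mu(f_{\mathfrak g}(x_1,\dots,x_n))u+\mu(x_n)f_\rho(x_1,\dots,x_{n-1},u)-f_\rho(x_1,\dots,x_{n-1},\mu(x_n)u)\big)\\&+\sum_{i=1}^{n-1}(-1)^{i+1}\big(-f_\mu(x_1,\dots,\hat{x_i},\dots,x_{n-1},u,x_i\cdot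 x_n)+\rho(x_i)f_\mu(x_1,\dots,\hat{x_i},\dots,x_{n-1},u,x_n)\\&\qquad-f_\mu(x_1,\dots,\hat{x_i},\dots,x_{n-1},\rho(x_i)u,x_n)+\mu(x_n)f_\mu(x_1,\dots,\hat{x_i},\dots,x_{n-1},u,x_i)\\&\qquad+f_\mu(x_1,\dots,\hat{x_i},\dots,x_{n-1},\mu(x_i)u,x_n)\big)\\&+\sum_{1\le i<j\le n-1}(-1)^{i+j}f_\mu([x_i,x_j],x_1,\dots,\hat{x_i},\dots,\hat{x_j},\dots,x_{n-1},u,x_n),\end{aligned}$$ and let $\delta f\in C^n(\mathfrak g;V)$ be $$\begin{aligned}(\delta f)(x_1,\dots,x_n)={}&\sum_{i=1}^{n-1}(-1)^{i+1}f_\mu(x_1,\dots,\hat{x_i},\dots,x_{n-1},D(x_i),x_n)\\&+(-1)^{n-2}\big(f_\rho(x_1,\dots,x_{n-1},D(x_n))-D(f_{\mathfrak g}(x_1,\dots,x_n))\big).\end{aligned}$$ Finally let $\mathcal D(f,\theta)=(\partial f,\mathrm d\theta+\delta f)$ for $(f,\theta)\in C^n(\mathfrak g,\pi,\rho,\mu,D)$.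 Write $C^{*-1}(\mathfrak g;V)$ for the complex whose term in degree $n$ is $C^{n-1}(\mathfrak g;V)$, with differential $\mathrm d$ (no sign change); its $n$-th cohomology group is $H^{n-1}(\mathfrak g;V)$. Theorem. These are cochain complexes, and there is a short exact sequence of cochain complexes $$0\longrightarrow (C^{*-1}(\mathfrak g;V),\mathrm d)\stackrel{\iota}{\longrightarrow}(C^*(\mathfrak g,\pi,\rho,\mu,D),\mathcal D)\stackrel{p}{\longrightarrow}(C^*(\mathfrak g,\pi,\rho,\mu),\partial)\longrightarrow0,$$ where $\iota(\theta)=(0,\theta)$ and $p(f,\theta)=f$. Consequently there is a long exact sequence of cohomology groups $$\cdots\to H^{n-1}(\mathfrak g;V)\stackrel{H^n(\iota)}{\longrightarrow}H^n(\mathfrak g,\pi,\rho,\mu,D)\stackrel{H^n(p)}{\longrightarrow}H^n(\mathfrak g,\pi,\rho,\mu)\stackrel{c^n}{\longrightarrow}H^{n}(\mathfrak g;V)\to H^{n+1}(\mathfrak g,\pi,\rho,\mu,D)\to\cdots,$$ whose connecting map is $c^n([\alpha])=[\delta\alpha]$ for every cocycle $\alpha\in C^n(\mathfrak g,\pi,\rho,\mu)$.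 -/

import Mathlib

open CategoryTheory

namespace PreLieDer

universe u v w

/-! ### Representations of pre-Lie algebras and pre-LieDer pairs -/

/-- A representation `(V; ρ, μ)` of a (left) pre-Lie algebra `g`: `ρ` is a representation of the
sub-adjacent Lie algebra (with bracket `[x, y] = x * y - y * x`), and
`μ y ∘ μ x - μ (x * y) = μ y ∘ ρ x - ρ x ∘ μ y`. -/
structure Rep (K : Type u) (g : Type v) (V : Type w) [Field K] [LeftPreLieRing g]
    [LeftPreLieAlgebra K g] [AddCommGroup V] [Module K V] where
  ρ : g →ₗ[K] Module.End K V
  μ : g →ₗ[K] Module.End K V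
  map_bracket : ∀ x y : g, ρ (x * y - y * x) = ρ x ∘ₗ ρ y - ρ y ∘ₗ ρ x
  compat : ∀ x y : g, μ y ∘ₗ μ x - μ (x * y) = μ y ∘ₗ ρ x - ρ x ∘ₗ μ y

/-- A pre-LieDer pair: a pre-Lie algebra `g`, a representation `(V; ρ, μ)` and a derivation
`D : g → V` with respect to it. -/
structure Pair (K : Type u) (g : Type v) (V : Type w) [Field K] [LeftPreLieRing g]
    [LeftPreLieAlgebra K g] [AddCommGroup V] [Module K V] extends Rep K g V where
  D : g →ₗ[K] V
  leibniz : ∀ x y : g, D (x * y) = ρ x (D y) + μ y (D x)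

/-- The regular representation `(g; L, R)`, `L x y = x * y`, `R x y = y * x`. -/
def Rep.regular (K : Type u) (g : Type v) [Field K] [LeftPreLieRing g]
    [LeftPreLieAlgebra K g] : Rep K g g where
  ρ := LinearMap.mul K g
  map_bracket := by
    intro x y
    ext z
    have h := LeftPreLieRing.assoc_symm x y z
    simp only [associator_apply] at h
    change (x * y - y * x) * z = x * (y * z) - y * (x * z)
    rw [sub_mul]
    grind
  μ := (LinearMap.mul K g).flip
  compat := by
    intro x y
    ext z
    have h := LeftPreLieRing.assoc_symm x z y
    simp only [associator_apply] at h
    change z * x * y - z * (x * y) = x * z * y - x * (z * y)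
    exact h.symm

/-! ### Alternating cochains

`Hom(∧^k g ⊗ M, N)` is encoded as `g [⋀^Fin k]→ₗ[K] (M →ₗ[K] N)`. -/

section Alternating

variable {K : Type u} {g : Type v} [Field K] [LeftPreLieRing g] [LeftPreLieAlgebra K g]
variable {N : Type*} {N' : Type*} [AddCommGroup N] [Module K N] [AddCommGroup N'] [Module K N']

/-- For `A : g → Hom(N, N')`, the map `f ↦ ∑ᵢ (-1)^(i+1) A(xᵢ) f(x₁, …, x̂ᵢ, …, xₖ₊₁)` (indices
from `1`), from `Hom(∧^k g, N)` to `Hom(∧^(k+1) g, N')`. -/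
def insertSum (A : g →ₗ[K] N →ₗ[K] N') (k : ℕ) :
    (g [⋀^Fin k]→ₗ[K] N) →ₗ[K] (g [⋀^Fin (k + 1)]→ₗ[K] N') where
  toFun f := AlternatingMap.alternatizeUncurryFin
    { toFun := fun x => (A x).compAlternatingMap f
      map_add' := fun x y => by ext; simp
      map_smul' := fun c x => by ext; simp }
  map_add' f f' := by
    ext; simp [AlternatingMap.alternatizeUncurryFin_apply, Finset.sum_add_distrib]
  map_smul' c f := by
    ext; simp [AlternatingMap.alternatizeUncurryFin_apply, Finset.smul_sum, smul_comm _ c]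

theorem insertSum_apply (A : g →ₗ[K] N →ₗ[K] N') (k : ℕ) (f : g [⋀^Fin k]→ₗ[K] N)
    (x : Fin (k + 1) → g) :
    insertSum A k f x = ∑ i : Fin (k + 1), (-1 : ℤ) ^ (i : ℕ) • A (x i) (f (i.removeNth x)) := by
  simp [insertSum, AlternatingMap.alternatizeUncurryFin_apply]

/-- The map `f ↦ ∑_{i<j} (-1)^(i+j) f([xᵢ, xⱼ], x₁, …, x̂ᵢ, …, x̂ⱼ, …, xₖ₊₁)` from `Hom(∧^k g, N)`
to `Hom(∧^(k+1) g, N)`; see `bracketSum_apply`. For `k = 0` the sum is empty. -/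
def bracketSum (K : Type u) (g : Type v) (N : Type*) [Field K] [LeftPreLieRing g]
    [LeftPreLieAlgebra K g] [AddCommGroup N] [Module K N] :
    ∀ k : ℕ, (g [⋀^Fin k]→ₗ[K] N) →ₗ[K] (g [⋀^Fin (k + 1)]→ₗ[K] N)
  | 0 => 0
  | k + 1 =>
    { toFun := fun f => -AlternatingMap.alternatizeUncurryFin
        (AlternatingMap.alternatizeUncurryFinLM ∘ₗ (LinearMap.mul K g).compr₂ f.curryLeft)
      map_add' := fun f f' => by
        ext
        simp [AlternatingMap.alternatizeUncurryFin_apply, Finset.sum_add_distrib]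
        abel
      map_smul' := fun c f => by
        ext
        simp [AlternatingMap.alternatizeUncurryFin_apply, Finset.smul_sum, smul_comm _ c] }

/-- The pairs of positions `i < j` among `0, …, k + 1` are written as `(i.castSucc, j.succ)` with
`i ≤ j` among `0, …, k`, whence the sign `(-1)^(i + (j + 1))`. -/
theorem bracketSum_apply (k : ℕ) (f : g [⋀^Fin (k + 1)]→ₗ[K] N) (x : Fin (k + 2) → g) :
    bracketSum K g N (k + 1) f x =
      ∑ i : Fin (k + 1), ∑ j ≥ i, (-1 : ℤ) ^ ((i : ℕ) + ((j : ℕ) + 1)) •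
        f (Matrix.vecCons (x i.castSucc * x j.succ - x j.succ * x i.castSucc)
          (j.removeNth (i.castSucc.removeNth x))) := by
  have h := AlternatingMap.alternatizeUncurryFin_alternatizeUncurryFinLM_comp_apply
    ((LinearMap.mul K g).compr₂ f.curryLeft) x
  change (-AlternatingMap.alternatizeUncurryFin
        (AlternatingMap.alternatizeUncurryFinLM ∘ₗ (LinearMap.mul K g).compr₂ f.curryLeft)) x = _
  rw [AlternatingMap.neg_apply, h, ← Finset.sum_neg_distrib]
  refine Finset.sum_congr rfl fun i _ => ?_
  rw [← Finset.sum_neg_distrib]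
  refine Finset.sum_congr rfl fun j _ => ?_
  rw [← add_assoc, pow_succ, mul_neg_one, neg_smul]
  congr 2
  simp only [LinearMap.compr₂_apply, LinearMap.mul_apply_apply]
  rw [← AlternatingMap.sub_apply, ← map_sub]
  rfl

end Alternating

/-- `Hom(∧^(n-1) g, N)`, which is `0` for `n = 0`. -/
def AltPred (K : Type u) (g : Type v) (N : Type w) [Field K] [LeftPreLieRing g]
    [LeftPreLieAlgebra K g] [AddCommGroup N] [Module K N] : ℕ → Type (max v w)
  | 0 => PUnit.{max v w + 1}
  | n + 1 => g [⋀^Fin n]→ₗ[K] N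

section Cochains

variable (K : Type u) (g : Type v) (N : Type w) (V : Type w) [Field K] [LeftPreLieRing g]
  [LeftPreLieAlgebra K g] [AddCommGroup N] [Module K N] [AddCommGroup V] [Module K V]

instance : ∀ n, AddCommGroup (AltPred K g N n)
  | 0 => inferInstanceAs (AddCommGroup PUnit.{max v w + 1})
  | n + 1 => inferInstanceAs (AddCommGroup (g [⋀^Fin n]→ₗ[K] N))

instance : ∀ n, Module K (AltPred K g N n)
  | 0 => (inferInstance : Module K PUnit.{max v w + 1})
  | n + 1 => (inferInstance : Module K (g [⋀^Fin n]→ₗ[K] N))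

/-- `C^n(g; V) = Hom(∧^(n-1) g ⊗ g, V)` for `n ≥ 1`, and `C^0(g; V) = 0`. -/
abbrev CV (n : ℕ) : Type (max v w) := AltPred K g (g →ₗ[K] V) n

/-- The degree `n` term `C^(n-1)(g; V)` of the shifted complex `C^(*-1)(g; V)`; it is `0` in
degree `0` (and in degree `1`). -/
def CVShift : ℕ → Type (max v w)
  | 0 => PUnit.{max v w + 1}
  | n + 1 => CV K g V n

instance : ∀ n, AddCommGroup (CVShift K g V n)
  | 0 => inferInstanceAs (AddCommGroup PUnit.{max v w + 1})
  | n + 1 => inferInstanceAs (AddCommGroup (CV K g V n))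

instance : ∀ n, Module K (CVShift K g V n)
  | 0 => (inferInstance : Module K PUnit.{max v w + 1})
  | n + 1 => (inferInstance : Module K (CV K g V n))

/-- `C^n(g, π, ρ, μ)`: the triples `(f_g, f_ρ, f_μ)` in
`Hom(∧^(n-1) g ⊗ g, g) ⊕ Hom(∧^(n-1) g ⊗ V, V) ⊕ Hom(∧^(n-2) g ⊗ V ⊗ g, V)` for `n ≥ 1` (without
the third summand if `n = 1`), and `0` for `n = 0`. -/
def CRep : ℕ → Type (max v w)
  | 0 => PUnit.{max v w + 1}
  | n + 1 => (g [⋀^Fin n]→ₗ[K] (g →ₗ[K] g)) × (g [⋀^Fin n]→ₗ[K] (V →ₗ[K] V)) ×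
      AltPred K g (V →ₗ[K] g →ₗ[K] V) n

instance : ∀ n, AddCommGroup (CRep K g V n)
  | 0 => inferInstanceAs (AddCommGroup PUnit.{max v w + 1})
  | n + 1 => inferInstanceAs (AddCommGroup ((g [⋀^Fin n]→ₗ[K] (g →ₗ[K] g)) ×
      (g [⋀^Fin n]→ₗ[K] (V →ₗ[K] V)) × AltPred K g (V →ₗ[K] g →ₗ[K] V) n))

instance : ∀ n, Module K (CRep K g V n)
  | 0 => (inferInstance : Module K PUnit.{max v w + 1})
  | n + 1 => (inferInstance : Module K ((g [⋀^Fin n]→ₗ[K] (g →ₗ[K] g)) ×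
      (g [⋀^Fin n]→ₗ[K] (V →ₗ[K] V)) × AltPred K g (V →ₗ[K] g →ₗ[K] V) n))

/-- `C^n(g, π, ρ, μ, D) = C^n(g, π, ρ, μ) ⊕ C^(n-1)(g; V)`; this is `0` for `n = 0` and
`Hom(g, g) ⊕ Hom(V, V)` for `n = 1`. -/
abbrev CPair (n : ℕ) : Type (max v w) := CRep K g V n × CVShift K g V n

end Cochains

/-! ### The coboundary operators -/

section Operators

variable {K : Type u} {g : Type v} {V : Type w} [Field K] [LeftPreLieRing g]
  [LeftPreLieAlgebra K g] [AddCommGroup V] [Module K V]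

/-- `(x, φ) ↦ (y ↦ ρ(x) φ(y) + μ(y) φ(x) - φ(x · y))` on `Hom(g, V)`. -/
def Rep.actHom (P : Rep K g V) : g →ₗ[K] (g →ₗ[K] V) →ₗ[K] (g →ₗ[K] V) :=
  LinearMap.mk₂ K
    (fun x φ => P.ρ x ∘ₗ φ + P.μ.flip (φ x) - φ ∘ₗ LinearMap.mul K g x)
    (fun x x' φ => by ext; simp; abel)
    (fun c x φ => by ext; simp [smul_add, smul_sub])
    (fun x φ φ' => by ext; simp; abel)
    (fun c x φ => by ext; simp [smul_add, smul_sub])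

/-- The coboundary operator `Hom(∧^k g ⊗ g, V) → Hom(∧^(k+1) g ⊗ g, V)` of the pre-Lie algebra `g`
with coefficients in `(V; ρ, μ)`; see `Rep.dHom_apply_succ` for the explicit formula. -/
def Rep.dHom (P : Rep K g V) (k : ℕ) :
    (g [⋀^Fin k]→ₗ[K] (g →ₗ[K] V)) →ₗ[K] (g [⋀^Fin (k + 1)]→ₗ[K] (g →ₗ[K] V)) :=
  insertSum P.actHom k + bracketSum K g (g →ₗ[K] V) k

theorem Rep.dHom_apply_zero (P : Rep K g V) (f : g [⋀^Fin 0]→ₗ[K] (g →ₗ[K] V))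
    (x : Fin 1 → g) (y : g) :
    P.dHom 0 f x y = P.ρ (x 0) (f ![] y) + P.μ y (f ![] (x 0)) - f ![] (x 0 * y) := by
  have h : (0 : Fin 1).removeNth x = ![] := Subsingleton.elim _ _
  simp [Rep.dHom, insertSum_apply, bracketSum, Rep.actHom, h]

theorem Rep.dHom_apply_succ (P : Rep K g V) (k : ℕ) (f : g [⋀^Fin (k + 1)]→ₗ[K] (g →ₗ[K] V))
    (x : Fin (k + 2) → g) (y : g) :
    P.dHom (k + 1) f x y =
      ∑ i : Fin (k + 2), (-1 : ℤ) ^ (i : ℕ) • P.ρ (x i) (f (i.removeNth x) y)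
      + ∑ i : Fin (k + 2), (-1 : ℤ) ^ (i : ℕ) • P.μ y (f (i.removeNth x) (x i))
      - ∑ i : Fin (k + 2), (-1 : ℤ) ^ (i : ℕ) • f (i.removeNth x) (x i * y)
      + ∑ i : Fin (k + 1), ∑ j ≥ i, (-1 : ℤ) ^ ((i : ℕ) + ((j : ℕ) + 1)) •
        f (Matrix.vecCons (x i.castSucc * x j.succ - x j.succ * x i.castSucc)
          (j.removeNth (i.castSucc.removeNth x))) y := by
  simp [Rep.dHom, insertSum_apply, bracketSum_apply, Rep.actHom, LinearMap.sum_apply, smul_add,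
    smul_sub, Finset.sum_add_distrib, Finset.sum_sub_distrib]

/-- The coboundary operator `d : C^n(g; V) → C^(n+1)(g; V)`. -/
def Rep.d (P : Rep K g V) : ∀ n, CV K g V n →ₗ[K] CV K g V (n + 1)
  | 0 => 0
  | n + 1 => P.dHom n

/-- The same operator as the differential `C^(n-1)(g; V) → C^n(g; V)` of the shifted complex. -/
def Rep.dShift (P : Rep K g V) : ∀ n, CVShift K g V n →ₗ[K] CVShift K g V (n + 1)
  | 0 => 0
  | n + 1 => P.d n

/-- `(x, φ) ↦ (u ↦ ρ(φ(x)) u)`, from `g ⊗ Hom(g, g)` to `Hom(V, V)`. -/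
def Rep.rhoIns (P : Rep K g V) : g →ₗ[K] (g →ₗ[K] g) →ₗ[K] (V →ₗ[K] V) :=
  LinearMap.mk₂ K (fun x φ => P.ρ (φ x))
    (fun x x' φ => by simp) (fun c x φ => by simp) (fun x φ φ' => by simp)
    (fun c x φ => by simp)

/-- `(x, φ) ↦ (u ↦ ρ(x) φ(u) - φ(ρ(x) u))` on `Hom(V, V)`. -/
def Rep.actRho (P : Rep K g V) : g →ₗ[K] (V →ₗ[K] V) →ₗ[K] (V →ₗ[K] V) :=
  LinearMap.mk₂ K (fun x φ => P.ρ x ∘ₗ φ - φ ∘ₗ P.ρ x)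
    (fun x x' φ => by ext; simp; abel)
    (fun c x φ => by ext; simp [smul_sub])
    (fun x φ φ' => by ext; simp; abel)
    (fun c x φ => by ext; simp [smul_sub])

/-- `(∂f)_ρ` as a function of `f_g` and `f_ρ` (of degree `k + 1`); see `Rep.partialRho_apply_succ`
for the explicit formula. -/
def Rep.partialRho (P : Rep K g V) (k : ℕ) :
    (g [⋀^Fin k]→ₗ[K] (g →ₗ[K] g)) × (g [⋀^Fin k]→ₗ[K] (V →ₗ[K] V)) →ₗ[K]
      (g [⋀^Fin (k + 1)]→ₗ[K] (V →ₗ[K] V)) :=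
  LinearMap.coprod (insertSum P.rhoIns k)
    (insertSum P.actRho k + bracketSum K g (V →ₗ[K] V) k)

theorem Rep.partialRho_apply_zero (P : Rep K g V) (fg : g [⋀^Fin 0]→ₗ[K] (g →ₗ[K] g))
    (fρ : g [⋀^Fin 0]→ₗ[K] (V →ₗ[K] V)) (x : Fin 1 → g) (v : V) :
    P.partialRho 0 (fg, fρ) x v =
      P.ρ (fg ![] (x 0)) v + P.ρ (x 0) (fρ ![] v) - fρ ![] (P.ρ (x 0) v) := by
  have h : (0 : Fin 1).removeNth x = ![] := Subsingleton.elim _ _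
  simp [Rep.partialRho, insertSum_apply, bracketSum, Rep.rhoIns, Rep.actRho, h]
  abel

theorem Rep.partialRho_apply_succ (P : Rep K g V) (k : ℕ)
    (fg : g [⋀^Fin (k + 1)]→ₗ[K] (g →ₗ[K] g)) (fρ : g [⋀^Fin (k + 1)]→ₗ[K] (V →ₗ[K] V))
    (x : Fin (k + 2) → g) (v : V) :
    P.partialRho (k + 1) (fg, fρ) x v =
      ∑ i : Fin (k + 2), (-1 : ℤ) ^ (i : ℕ) • P.ρ (fg (i.removeNth x) (x i)) v
      + ∑ i : Fin (k + 2), (-1 : ℤ) ^ (i : ℕ) • P.ρ (x i) (fρ (i.removeNth x) v)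
      - ∑ i : Fin (k + 2), (-1 : ℤ) ^ (i : ℕ) • fρ (i.removeNth x) (P.ρ (x i) v)
      + ∑ i : Fin (k + 1), ∑ j ≥ i, (-1 : ℤ) ^ ((i : ℕ) + ((j : ℕ) + 1)) •
        fρ (Matrix.vecCons (x i.castSucc * x j.succ - x j.succ * x i.castSucc)
          (j.removeNth (i.castSucc.removeNth x))) v := by
  simp [Rep.partialRho, insertSum_apply, bracketSum_apply, Rep.rhoIns, Rep.actRho,
    LinearMap.sum_apply, smul_sub, Finset.sum_sub_distrib, ← add_assoc, ← add_sub_assoc,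
    -zsmul_eq_mul]

/-- `(φ, ψ) ↦ ((u, y) ↦ μ(φ(y)) u + μ(y) ψ(u) - ψ(μ(y) u))`, from `Hom(g, g) ⊕ Hom(V, V)` to
`Hom(V ⊗ g, V)`. -/
def Rep.muBase (P : Rep K g V) :
    (g →ₗ[K] g) × (V →ₗ[K] V) →ₗ[K] (V →ₗ[K] g →ₗ[K] V) where
  toFun p := (P.μ ∘ₗ p.1).flip + P.μ.flip ∘ₗ p.2 - P.μ.flip.compr₂ p.2
  map_add' p q := by ext; simp; abel
  map_smul' c p := by ext; simp [smul_add, smul_sub]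

/-- `(x, φ) ↦ ((u, y) ↦ -φ(u, x · y) + ρ(x) φ(u, y) - φ(ρ(x) u, y) + μ(y) φ(u, x) + φ(μ(x) u, y))`
on `Hom(V ⊗ g, V)`. -/
def Rep.actMu (P : Rep K g V) :
    g →ₗ[K] (V →ₗ[K] g →ₗ[K] V) →ₗ[K] (V →ₗ[K] g →ₗ[K] V) :=
  LinearMap.mk₂ K
    (fun x φ => -(φ.compl₂ (LinearMap.mul K g x)) + φ.compr₂ (P.ρ x) - φ ∘ₗ P.ρ x
      + P.μ.flip ∘ₗ φ.flip x + φ ∘ₗ P.μ x)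
    (fun x x' φ => by ext; simp; abel)
    (fun c x φ => by ext; simp [smul_add, smul_sub])
    (fun x φ φ' => by ext; simp; abel)
    (fun c x φ => by ext; simp [smul_add, smul_sub])

/-- `f ↦ A ∘ f`, as a linear map. -/
def compLM {N : Type*} {N' : Type*} [AddCommGroup N] [Module K N] [AddCommGroup N'] [Module K N']
    (A : N →ₗ[K] N') (k : ℕ) : (g [⋀^Fin k]→ₗ[K] N) →ₗ[K] (g [⋀^Fin k]→ₗ[K] N') where
  toFun f := A.compAlternatingMap f
  map_add' f f' := by ext; simp
  map_smul' c f := by ext; simp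

/-- The contribution of `f_g` and `f_ρ` (of degree `k + 1`) to `(∂f)_μ`. -/
def Rep.partialMuBase (P : Rep K g V) (k : ℕ) :
    (g [⋀^Fin k]→ₗ[K] (g →ₗ[K] g)) × (g [⋀^Fin k]→ₗ[K] (V →ₗ[K] V)) →ₗ[K]
      (g [⋀^Fin k]→ₗ[K] (V →ₗ[K] g →ₗ[K] V)) :=
  (-1 : ℤ) ^ k • LinearMap.coprod
    (compLM (P.muBase ∘ₗ LinearMap.inl K (g →ₗ[K] g) (V →ₗ[K] V)) k)
    (compLM (P.muBase ∘ₗ LinearMap.inr K (g →ₗ[K] g) (V →ₗ[K] V)) k)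

theorem Rep.partialMuBase_apply (P : Rep K g V) (k : ℕ) (fg : g [⋀^Fin k]→ₗ[K] (g →ₗ[K] g))
    (fρ : g [⋀^Fin k]→ₗ[K] (V →ₗ[K] V)) (x : Fin k → g) (v : V) (y : g) :
    P.partialMuBase k (fg, fρ) x v y =
      (-1 : ℤ) ^ k • (P.μ (fg x y) v + P.μ y (fρ x v) - fρ x (P.μ y v)) := by
  simp [Rep.partialMuBase, compLM, Rep.muBase, add_sub_assoc]

/-- The contribution of `f_μ` to `(∂f)_μ`. -/
def Rep.partialMuMu (P : Rep K g V) :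
    ∀ k, AltPred K g (V →ₗ[K] g →ₗ[K] V) k →ₗ[K] (g [⋀^Fin k]→ₗ[K] (V →ₗ[K] g →ₗ[K] V))
  | 0 => 0
  | k + 1 => insertSum P.actMu k + bracketSum K g (V →ₗ[K] g →ₗ[K] V) k

theorem Rep.partialMuMu_apply_one (P : Rep K g V) (f : g [⋀^Fin 0]→ₗ[K] (V →ₗ[K] g →ₗ[K] V))
    (x : Fin 1 → g) (v : V) (y : g) :
    P.partialMuMu 1 f x v y =
      -f ![] v (x 0 * y) + P.ρ (x 0) (f ![] v y) - f ![] (P.ρ (x 0) v) y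
        + P.μ y (f ![] v (x 0)) + f ![] (P.μ (x 0) v) y := by
  have h : (0 : Fin 1).removeNth x = ![] := Subsingleton.elim _ _
  change ((insertSum P.actMu 0 + bracketSum K g (V →ₗ[K] g →ₗ[K] V) 0) f) x v y = _
  simp [insertSum_apply, bracketSum, Rep.actMu, h]

theorem Rep.partialMuMu_apply_succ (P : Rep K g V) (k : ℕ)
    (f : g [⋀^Fin (k + 1)]→ₗ[K] (V →ₗ[K] g →ₗ[K] V)) (x : Fin (k + 2) → g) (v : V) (y : g) :
    P.partialMuMu (k + 2) f x v y =
      -∑ i : Fin (k + 2), (-1 : ℤ) ^ (i : ℕ) • f (i.removeNth x) v (x i * y)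
      + ∑ i : Fin (k + 2), (-1 : ℤ) ^ (i : ℕ) • P.ρ (x i) (f (i.removeNth x) v y)
      - ∑ i : Fin (k + 2), (-1 : ℤ) ^ (i : ℕ) • f (i.removeNth x) (P.ρ (x i) v) y
      + ∑ i : Fin (k + 2), (-1 : ℤ) ^ (i : ℕ) • P.μ y (f (i.removeNth x) v (x i))
      + ∑ i : Fin (k + 2), (-1 : ℤ) ^ (i : ℕ) • f (i.removeNth x) (P.μ (x i) v) y
      + ∑ i : Fin (k + 1), ∑ j ≥ i, (-1 : ℤ) ^ ((i : ℕ) + ((j : ℕ) + 1)) •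
        f (Matrix.vecCons (x i.castSucc * x j.succ - x j.succ * x i.castSucc)
          (j.removeNth (i.castSucc.removeNth x))) v y := by
  change ((insertSum P.actMu (k + 1) + bracketSum K g (V →ₗ[K] g →ₗ[K] V) (k + 1)) f) x v y = _
  simp [insertSum_apply, bracketSum_apply, Rep.actMu, LinearMap.sum_apply,
    smul_add, smul_sub, Finset.sum_add_distrib, Finset.sum_sub_distrib]

/-- The coboundary operator `∂ : C^n(g, π, ρ, μ) → C^(n+1)(g, π, ρ, μ)`,
`∂f = ((∂f)_g, (∂f)_ρ, (∂f)_μ)`, where `(∂f)_g` is the coboundary of `f_g` with coefficients in the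
regular representation. -/
def Rep.partialD (P : Rep K g V) : ∀ n, CRep K g V n →ₗ[K] CRep K g V (n + 1)
  | 0 => 0
  | n + 1 =>
    { toFun := fun f =>
        ((Rep.regular K g).dHom n f.1, P.partialRho n (f.1, f.2.1),
          P.partialMuBase n (f.1, f.2.1) + P.partialMuMu n f.2.2)
      map_add' := fun f f' => by
        refine Prod.ext (map_add _ _ _) (Prod.ext ?_ ?_)
        · exact map_add (P.partialRho n) (f.1, f.2.1) (f'.1, f'.2.1)
        · have h1 := map_add (P.partialMuBase n) (f.1, f.2.1) (f'.1, f'.2.1)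
          have h2 := map_add (P.partialMuMu n) f.2.2 f'.2.2
          exact (congrArg₂ (· + ·) h1 h2).trans (add_add_add_comm _ _ _ _)
      map_smul' := fun c f => by
        refine Prod.ext (map_smul _ _ _) (Prod.ext ?_ ?_)
        · exact map_smul (P.partialRho n) c (f.1, f.2.1)
        · have h1 := map_smul (P.partialMuBase n) c (f.1, f.2.1)
          have h2 := map_smul (P.partialMuMu n) c f.2.2
          exact (congrArg₂ (· + ·) h1 h2).trans (smul_add _ _ _).symm }

/-- `(x, φ) ↦ (y ↦ φ(D(x), y))`, from `g ⊗ Hom(V ⊗ g, V)` to `Hom(g, V)`. -/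
def Pair.insD (P : Pair K g V) : g →ₗ[K] (V →ₗ[K] g →ₗ[K] V) →ₗ[K] (g →ₗ[K] V) :=
  LinearMap.mk₂ K (fun x φ => φ (P.D x))
    (fun x x' φ => by simp) (fun c x φ => by simp) (fun x φ φ' => by simp)
    (fun c x φ => by simp)

/-- The contribution of `f_μ` to `δf`. -/
def Pair.deltaMu (P : Pair K g V) :
    ∀ k, AltPred K g (V →ₗ[K] g →ₗ[K] V) k →ₗ[K] (g [⋀^Fin k]→ₗ[K] (g →ₗ[K] V))
  | 0 => 0
  | k + 1 => insertSum P.insD k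

theorem Pair.deltaMu_apply (P : Pair K g V) (k : ℕ) (f : g [⋀^Fin k]→ₗ[K] (V →ₗ[K] g →ₗ[K] V))
    (x : Fin (k + 1) → g) (y : g) :
    P.deltaMu (k + 1) f x y =
      ∑ i : Fin (k + 1), (-1 : ℤ) ^ (i : ℕ) • f (i.removeNth x) (P.D (x i)) y := by
  change insertSum P.insD k f x y = _
  simp [insertSum_apply, Pair.insD, LinearMap.sum_apply]

/-- `φ ↦ (y ↦ φ(D(y)))`, from `Hom(V, V)` to `Hom(g, V)`. -/
def Pair.preD (P : Pair K g V) : (V →ₗ[K] V) →ₗ[K] (g →ₗ[K] V) := LinearMap.lcomp K V P.D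

/-- `φ ↦ (y ↦ D(φ(y)))`, from `Hom(g, g)` to `Hom(g, V)`. -/
def Pair.postD (P : Pair K g V) : (g →ₗ[K] g) →ₗ[K] (g →ₗ[K] V) := P.D.compRight K

/-- The contribution of `f_g` and `f_ρ` (of degree `n = k + 1`) to `δf`; the sign is
`(-1)^(n-2) = (-1)^(k+1)`. -/
def Pair.deltaBase (P : Pair K g V) (k : ℕ) :
    (g [⋀^Fin k]→ₗ[K] (g →ₗ[K] g)) × (g [⋀^Fin k]→ₗ[K] (V →ₗ[K] V)) →ₗ[K]
      (g [⋀^Fin k]→ₗ[K] (g →ₗ[K] V)) :=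
  (-1 : ℤ) ^ (k + 1) • LinearMap.coprod (-compLM P.postD k) (compLM P.preD k)

theorem Pair.deltaBase_apply (P : Pair K g V) (k : ℕ) (fg : g [⋀^Fin k]→ₗ[K] (g →ₗ[K] g))
    (fρ : g [⋀^Fin k]→ₗ[K] (V →ₗ[K] V)) (x : Fin k → g) (y : g) :
    P.deltaBase k (fg, fρ) x y = (-1 : ℤ) ^ (k + 1) • (fρ x (P.D y) - P.D (fg x y)) := by
  simp [Pair.deltaBase, compLM, Pair.postD, Pair.preD, neg_add_eq_sub]

/-- The operator `δ : C^n(g, π, ρ, μ) → C^n(g; V)`; its target is the degree `n + 1` term of the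
shifted complex. -/
def Pair.delta (P : Pair K g V) : ∀ n, CRep K g V n →ₗ[K] CVShift K g V (n + 1)
  | 0 => 0
  | n + 1 =>
    { toFun := fun f => P.deltaMu n f.2.2 + P.deltaBase n (f.1, f.2.1)
      map_add' := fun f f' => by
        have h1 := map_add (P.deltaMu n) f.2.2 f'.2.2
        have h2 := map_add (P.deltaBase n) (f.1, f.2.1) (f'.1, f'.2.1)
        exact (congrArg₂ (· + ·) h1 h2).trans (add_add_add_comm _ _ _ _)
      map_smul' := fun c f => by
        have h1 := map_smul (P.deltaMu n) c f.2.2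
        have h2 := map_smul (P.deltaBase n) c (f.1, f.2.1)
        exact (congrArg₂ (· + ·) h1 h2).trans (smul_add _ _ _).symm }

/-- The coboundary operator `(f, θ) ↦ (∂f, dθ + δf)` of the pre-LieDer pair. -/
def Pair.pairD (P : Pair K g V) (n : ℕ) : CPair K g V n →ₗ[K] CPair K g V (n + 1) :=
  LinearMap.prod (P.partialD n ∘ₗ LinearMap.fst K _ _)
    (P.dShift n ∘ₗ LinearMap.snd K _ _ + P.delta n ∘ₗ LinearMap.fst K _ _)

theorem Pair.pairD_apply (P : Pair K g V) (n : ℕ) (f : CRep K g V n) (θ : CVShift K g V n) :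
    P.pairD n (f, θ) = (P.partialD n f, P.dShift n θ + P.delta n f) := rfl

end Operators

/-! ### Cochain complexes and cohomology classes -/

section Complexes

variable {K : Type u} [Field K] (X : ℕ → Type w) [∀ n, AddCommGroup (X n)] [∀ n, Module K (X n)]
  (d : ∀ n, X n →ₗ[K] X (n + 1))

/-- The cochain complex `X 0 → X 1 → X 2 → ⋯` of `K`-vector spaces. -/
noncomputable def complexOf (h : ∀ n, d (n + 1) ∘ₗ d n = 0) : CochainComplex (ModuleCat.{w} K) ℕ :=
  CochainComplex.of (fun n => ModuleCat.of K (X n)) (fun n => ModuleCat.ofHom (d n))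
    (fun n => ModuleCat.hom_ext (h n))

theorem complexOf_d (h : ∀ n, d (n + 1) ∘ₗ d n = 0) (n : ℕ) :
    (complexOf X d h).d n (n + 1) = ModuleCat.ofHom (d n) :=
  CochainComplex.of_d (fun n => ModuleCat.of K (X n)) (fun n => ModuleCat.ofHom (d n)) n

/-- The class `[x]` in the `n`-th cohomology group of a cocycle `x` of degree `n`. -/
noncomputable def cohClass (h : ∀ n, d (n + 1) ∘ₗ d n = 0) (n : ℕ) (x : X n) (hx : d n x = 0) :
    (complexOf X d h).homology n :=
  ((complexOf X d h).homologyπ n).hom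
    ((complexOf X d h).cyclesMk (i := n) x (n + 1) (by simp) (by rw [complexOf_d]; exact hx))

end Complexes

end PreLieDer

/-!
The short exact sequence and its long exact sequence are formal once three identities are known:
`d ∘ d = 0`, `∂ ∘ ∂ = 0` and `d ∘ δ + δ ∘ ∂ = 0`. They say that the differential
`(f, θ) ↦ (∂f, dθ + δf)` of the pair squares to zero, and that lifting a cocycle `α` to `(α, 0)` and
applying this differential gives `(0, δα)`, so that the connecting map is `[α] ↦ [δα]`.

All three identities are instances of the Chevalley-Eilenberg calculus of the sub-adjacent Lie
algebra. An operator `insertSum A` inserts `A(xᵢ)` with alternating signs, and `bracketSum` inserts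
the brackets `[xᵢ, xⱼ]`. Written as iterated alternatizations of multilinear maps, they satisfy
* `insertSum_insertSum`: a composite of two insertions antisymmetrizes `A'(x) A(y)`;
* `insertSum_bracketSum_add`: the anticommutator of `insertSum A` with `bracketSum` is minus the
  antisymmetrization of `A(x * y)`;
* `bracketSum_bracketSum`: the bracket part squares to zero, because the associator of a pre-Lie
  algebra is symmetric in its first two arguments.

Hence a sum of insertions and brackets squares to zero as soon as `A` is a Lie algebra
representation, and the composites vanish in general when a pointwise identity holds
(`insertSum_comp_add_eq_zero`). The cochain spaces are cochains with values in `Hom(g, V)`, in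
`Hom(g, g) ⊕ Hom(V, V)` and in `Hom(V ⊗ g, V)`. These are representations (`Rep.actHom_bracket`,
`Rep.rhoIns_bracket`, `Rep.actRho_bracket`, `Rep.actMu_bracket`), and the remaining part
`Rep.muBase` of `∂` is an equivariant map between two of them (`Rep.muBase_actHom`,
`Rep.muBase_actRho`), so the signs `(-1)^(n-1)` make it anticommute with the coboundaries. The
operator `δ` is treated in the same way, using that `D` is a derivation (`Pair.insD_bracket`,
`Pair.postD_actHom`, `Pair.preD_actRho`).
-/

namespace PreLieDer

universe u v w

/-! ### Iterated alternatization -/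

section Iterated

variable {R M N N' : Type*} [CommRing R] [AddCommGroup M] [Module R M] [AddCommGroup N] [Module R N]
  [AddCommGroup N'] [Module R N']

open AlternatingMap

/-- Alternatization of a map that is bilinear in its first two arguments and alternating in the
remaining ones. -/
def altTwo {n : ℕ} : (M →ₗ[R] M →ₗ[R] M [⋀^Fin n]→ₗ[R] N) →ₗ[R] M [⋀^Fin (n + 2)]→ₗ[R] N :=
  alternatizeUncurryFinLM ∘ₗ alternatizeUncurryFinLM.compRight R

/-- Alternatization of a map that is trilinear in its first three arguments and alternating in the
remaining ones. -/
def altThree {n : ℕ} :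
    (M →ₗ[R] M →ₗ[R] M →ₗ[R] M [⋀^Fin n]→ₗ[R] N) →ₗ[R] M [⋀^Fin (n + 3)]→ₗ[R] N :=
  alternatizeUncurryFinLM ∘ₗ altTwo.compRight R

/-- Alternatization of a map that is multilinear in its first four arguments and alternating in the
remaining ones. -/
def altFour {n : ℕ} :
    (M →ₗ[R] M →ₗ[R] M →ₗ[R] M →ₗ[R] M [⋀^Fin n]→ₗ[R] N) →ₗ[R] M [⋀^Fin (n + 4)]→ₗ[R] N :=
  alternatizeUncurryFinLM ∘ₗ altThree.compRight R

variable {n : ℕ}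

theorem altTwo_eq_zero_of_symmetric {F : M →ₗ[R] M →ₗ[R] M [⋀^Fin n]→ₗ[R] N}
    (h : ∀ x y, F x y = F y x) : altTwo F = 0 :=
  alternatizeUncurryFin_alternatizeUncurryFinLM_comp_of_symmetric h

theorem altTwo_swap {F G : M →ₗ[R] M →ₗ[R] M [⋀^Fin n]→ₗ[R] N} (h : ∀ x y, G x y = F y x) :
    altTwo G = -altTwo F := by
  rw [eq_neg_iff_add_eq_zero, ← map_add]
  exact altTwo_eq_zero_of_symmetric fun x y => by simp [h, add_comm]

theorem altTwo_swap_neg {F G : M →ₗ[R] M →ₗ[R] M [⋀^Fin n]→ₗ[R] N} (h : ∀ x y, G x y = -F y x) :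
    altTwo G = altTwo F := by
  rw [← sub_eq_zero, ← map_sub]
  exact altTwo_eq_zero_of_symmetric fun x y => by simp [h]; abel

theorem altThree_swap {F G : M →ₗ[R] M →ₗ[R] M →ₗ[R] M [⋀^Fin n]→ₗ[R] N}
    (h : ∀ x y, G x y = F y x) : altThree G = -altThree F :=
  altTwo_swap (F := F.compr₂ alternatizeUncurryFinLM) (G := G.compr₂ alternatizeUncurryFinLM)
    fun x y => congrArg alternatizeUncurryFinLM (h x y)

theorem altThree_swap_right {F G : M →ₗ[R] M →ₗ[R] M →ₗ[R] M [⋀^Fin n]→ₗ[R] N}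
    (h : ∀ x y z, G x y z = F x z y) : altThree G = -altThree F := by
  change alternatizeUncurryFinLM _ = -alternatizeUncurryFinLM _
  rw [← map_neg]
  congr 1
  ext1 x
  exact altTwo_swap (h x)

/-- Alternatization is invariant under cyclic permutations of three arguments. -/
theorem altThree_rotate {F G : M →ₗ[R] M →ₗ[R] M →ₗ[R] M [⋀^Fin n]→ₗ[R] N}
    (h : ∀ x y z, G x y z = F z x y) : altThree G = altThree F := by
  rw [altThree_swap_right (F := F.flip) h, altThree_swap (F := F) fun _ _ => rfl, neg_neg]

theorem altFour_swap {F G : M →ₗ[R] M →ₗ[R] M →ₗ[R] M →ₗ[R] M [⋀^Fin n]→ₗ[R] N}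
    (h : ∀ x y, G x y = F y x) : altFour G = -altFour F :=
  altTwo_swap (F := F.compr₂ altTwo) (G := G.compr₂ altTwo) fun x y => congrArg altTwo (h x y)

/-- If exchanging the first two arguments with the next two changes the sign, then the
alternatization vanishes, since this exchange is an even permutation. -/
theorem altFour_eq_zero [IsAddTorsionFree N]
    {F : M →ₗ[R] M →ₗ[R] M →ₗ[R] M →ₗ[R] M [⋀^Fin n]→ₗ[R] N}
    (h : ∀ x y z w, F z w x y = -F x y z w) : altFour F = 0 := by
  -- the exchange `(x, y, z, w) ↦ (z, w, x, y)` as the product of the transpositions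
  -- `(2 3)`, `(1 2)`, `(3 4)`, `(2 3)` of positions
  let G := LinearMap.lflip.toLinearMap ∘ₗ F
  have h₁ : altFour G.flip = -altFour G := altFour_swap fun _ _ => rfl
  have h₂ : altFour G.flip = altFour G := by
    refine congrArg alternatizeUncurryFinLM (LinearMap.ext fun x => ?_)
    refine congrArg alternatizeUncurryFinLM (LinearMap.ext fun y => ?_)
    exact altTwo_swap_neg fun z w => h x w y z
  have h₃ : altFour G = -altFour F := by
    change alternatizeUncurryFinLM _ = -alternatizeUncurryFinLM _
    rw [← map_neg]
    exact congrArg alternatizeUncurryFinLM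
      (LinearMap.ext fun x => altThree_swap (F := F x) fun _ _ => rfl)
  have h₄ : altFour F = -altFour F := by rw [← h₃, ← h₂, h₁, h₃, neg_neg]
  ext v
  exact self_eq_neg.mp (congrArg (fun f => f v) h₄)

theorem altThree_sub {F G H : M →ₗ[R] M →ₗ[R] M →ₗ[R] M [⋀^Fin n]→ₗ[R] N}
    (h : ∀ x y z, H x y z = F x y z - G x y z) : altThree H = altThree F - altThree G := by
  change altTwo (H.compr₂ alternatizeUncurryFinLM) =
    altTwo (F.compr₂ alternatizeUncurryFinLM) - altTwo (G.compr₂ alternatizeUncurryFinLM)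
  rw [← map_sub]
  refine congrArg altTwo (LinearMap.ext₂ fun x y => ?_)
  change alternatizeUncurryFinLM _ = alternatizeUncurryFinLM _ - alternatizeUncurryFinLM _
  rw [← map_sub]
  exact congrArg alternatizeUncurryFinLM (LinearMap.ext (h x y))

theorem altThree_eq_of_sub_symmetric {F G : M →ₗ[R] M →ₗ[R] M →ₗ[R] M [⋀^Fin n]→ₗ[R] N}
    (h : ∀ x y z, F x y z - G x y z = F y x z - G y x z) : altThree F = altThree G := by
  change altTwo (F.compr₂ alternatizeUncurryFinLM) = altTwo (G.compr₂ alternatizeUncurryFinLM)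
  rw [← sub_eq_zero, ← map_sub]
  refine altTwo_eq_zero_of_symmetric fun x y => ?_
  change alternatizeUncurryFinLM _ - alternatizeUncurryFinLM _ =
    alternatizeUncurryFinLM _ - alternatizeUncurryFinLM _
  rw [← map_sub, ← map_sub]
  exact congrArg alternatizeUncurryFinLM (LinearMap.ext (h x y))

theorem curryLeft_alternatizeUncurryFin_zero (F : M →ₗ[R] M [⋀^Fin 0]→ₗ[R] N) (x : M) :
    (alternatizeUncurryFin F).curryLeft x = F x := by
  ext v
  simp [alternatizeUncurryFin_apply]

/-- The contraction of an alternatization with `x` either puts `x` into the first slot, or moves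
past that slot at the cost of a sign. -/
theorem curryLeft_alternatizeUncurryFin_succ (F : M →ₗ[R] M [⋀^Fin (n + 1)]→ₗ[R] N) (x : M) :
    (alternatizeUncurryFin F).curryLeft x =
      F x - alternatizeUncurryFin ((curryLeftLinearMap ∘ₗ F).flip x) := by
  ext v
  rw [curryLeft_apply_apply, alternatizeUncurryFin_apply, Fin.sum_univ_succ,
    AlternatingMap.sub_apply, alternatizeUncurryFin_apply, sub_eq_add_neg, ← Finset.sum_neg_distrib]
  congr 1
  · simp [Matrix.vecCons]
  refine Finset.sum_congr rfl fun i _ => ?_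
  have : i.succ.removeNth (Matrix.vecCons x v) = Matrix.vecCons x (i.removeNth v) := by
    ext j
    refine Fin.cases ?_ (fun j => ?_) j <;> simp [Fin.removeNth_apply, Matrix.vecCons]
  simp [this, pow_succ]

theorem curryLeft_curryLeft_swap (f : M [⋀^Fin (n + 2)]→ₗ[R] N) (x y : M) :
    (f.curryLeft x).curryLeft y = -(f.curryLeft y).curryLeft x := by
  have h := curryLeft_same f (x + y)
  simp only [map_add, curryLeft_add, LinearMap.add_apply, curryLeft_same, zero_add, add_zero] at h
  exact eq_neg_of_add_eq_zero_right h

end Iterated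

/-! ### Chevalley-Eilenberg calculus of a pre-Lie algebra -/

section Cartan
open AlternatingMap

variable {K : Type u} {g : Type v} [Field K] [LeftPreLieRing g] [LeftPreLieAlgebra K g]
variable {N N' N'' M' : Type*} [AddCommGroup N] [Module K N] [AddCommGroup N'] [Module K N']
  [AddCommGroup N''] [Module K N''] [AddCommGroup M'] [Module K M']

/-- Composition `(φ, f) ↦ φ ∘ f` of alternating maps with linear maps, as a linear map in `φ`. -/
def compRightLM {k : ℕ} (f : g [⋀^Fin k]→ₗ[K] N) : (N →ₗ[K] N') →ₗ[K] (g [⋀^Fin k]→ₗ[K] N') where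
  toFun φ := φ.compAlternatingMap f
  map_add' _ _ := by ext; simp
  map_smul' _ _ := by ext; simp

theorem insertSum_eq (A : g →ₗ[K] N →ₗ[K] N') (k : ℕ) (f : g [⋀^Fin k]→ₗ[K] N) :
    insertSum A k f = alternatizeUncurryFin (compRightLM f ∘ₗ A) := rfl

theorem bracketSum_succ_eq (k : ℕ) (f : g [⋀^Fin (k + 1)]→ₗ[K] N) :
    bracketSum K g N (k + 1) f = -altTwo ((LinearMap.mul K g).compr₂ f.curryLeft) := rfl

theorem compAlternatingMap_alternatizeUncurryFin (φ : N →ₗ[K] N') {k : ℕ}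
    (F : g →ₗ[K] g [⋀^Fin k]→ₗ[K] N) :
    φ.compAlternatingMap (alternatizeUncurryFin F) = alternatizeUncurryFin (compLM φ k ∘ₗ F) := by
  ext v
  simp [alternatizeUncurryFin_apply, compLM]

/-- `∑_{i<j} ± (C(xᵢ, xⱼ) - C(xⱼ, xᵢ)) f(…, x̂ᵢ, …, x̂ⱼ, …)`. -/
def pairSum {k : ℕ} (f : g [⋀^Fin k]→ₗ[K] N) :
    (g →ₗ[K] g →ₗ[K] N →ₗ[K] N') →ₗ[K] (g [⋀^Fin (k + 2)]→ₗ[K] N') where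
  toFun C := altTwo (C.compr₂ (compRightLM f))
  map_add' C C' := by
    rw [← map_add]
    exact congrArg altTwo (LinearMap.ext₂ fun x y => (compRightLM f).map_add _ _)
  map_smul' c C := by
    rw [← map_smul]
    exact congrArg altTwo (LinearMap.ext₂ fun x y => (compRightLM f).map_smul _ _)

theorem pairSum_eq_zero {k : ℕ} (f : g [⋀^Fin k]→ₗ[K] N) {C : g →ₗ[K] g →ₗ[K] N →ₗ[K] N'}
    (h : ∀ x y, C x y = C y x) : pairSum f C = 0 :=
  altTwo_eq_zero_of_symmetric fun x y => congrArg (compRightLM f) (h x y)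

theorem insertSum_insertSum (A' : g →ₗ[K] N' →ₗ[K] N'') (A : g →ₗ[K] N →ₗ[K] N') (k : ℕ)
    (f : g [⋀^Fin k]→ₗ[K] N) :
    insertSum A' (k + 1) (insertSum A k f) =
      pairSum f ((LinearMap.llcomp K N N' N'' ∘ₗ A').compl₂ A) := by
  rw [insertSum_eq, insertSum_eq]
  refine congrArg alternatizeUncurryFin (LinearMap.ext fun x => ?_)
  exact compAlternatingMap_alternatizeUncurryFin _ _

theorem curryLeft_insertSum_zero (A : g →ₗ[K] N →ₗ[K] N') (f : g [⋀^Fin 0]→ₗ[K] N) (x : g) :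
    (insertSum A 0 f).curryLeft x = (A x).compAlternatingMap f :=
  curryLeft_alternatizeUncurryFin_zero _ x

theorem curryLeft_insertSum_succ (A : g →ₗ[K] N →ₗ[K] N') (k : ℕ)
    (f : g [⋀^Fin (k + 1)]→ₗ[K] N) (x : g) :
    (insertSum A (k + 1) f).curryLeft x =
      (A x).compAlternatingMap f - insertSum A k (f.curryLeft x) :=
  curryLeft_alternatizeUncurryFin_succ _ x

/-- `(x, y, z) ↦ A(x) f(y * z, …)`. -/
def insertMul (A : g →ₗ[K] N →ₗ[K] N') {k : ℕ} (f : g [⋀^Fin (k + 1)]→ₗ[K] N) :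
    g →ₗ[K] g →ₗ[K] g →ₗ[K] g [⋀^Fin k]→ₗ[K] N' where
  toFun x := (LinearMap.mul K g).compr₂ (compLM (A x) k ∘ₗ f.curryLeft)
  map_add' x y := by ext; simp [compLM]
  map_smul' c x := by ext; simp [compLM]

/-- The homotopy formula relating the action part and the bracket part of the
Chevalley-Eilenberg coboundary. -/
theorem insertSum_bracketSum_add (A : g →ₗ[K] N →ₗ[K] N') (k : ℕ)
    (f : g [⋀^Fin k]→ₗ[K] N) :
    insertSum A (k + 1) (bracketSum K g N k f) + bracketSum K g N' (k + 1) (insertSum A k f) =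
      -pairSum f ((LinearMap.mul K g).compr₂ A) := by
  cases k with
  | zero =>
    rw [bracketSum_succ_eq]
    change insertSum A 1 0 + _ = _
    rw [_root_.map_zero, zero_add]
    refine congrArg Neg.neg (congrArg altTwo (LinearMap.ext₂ fun x y => ?_))
    exact curryLeft_insertSum_zero A f (x * y)
  | succ k =>
    have h1 : insertSum A (k + 2) (bracketSum K g N (k + 1) f) = -altThree (insertMul A f) := by
      rw [bracketSum_succ_eq, map_neg]
      refine congrArg Neg.neg (congrArg alternatizeUncurryFin (LinearMap.ext fun x => ?_))
      refine (compAlternatingMap_alternatizeUncurryFin _ _).trans ?_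
      refine congrArg alternatizeUncurryFin (LinearMap.ext fun y => ?_)
      exact compAlternatingMap_alternatizeUncurryFin _ _
    -- `(x, y, z) ↦ A(z) f(x * y, …)`
    let G : g →ₗ[K] g →ₗ[K] g →ₗ[K] g [⋀^Fin k]→ₗ[K] N' :=
      (LinearMap.mul K g).compr₂
        (LinearMap.mk₂ K (fun x z => (A z).compAlternatingMap (f.curryLeft x))
          (fun x x' z => by ext; simp) (fun c x z => by ext; simp)
          (fun x z z' => by ext; simp) (fun c x z => by ext; simp))
    have h2 : bracketSum K g N' (k + 2) (insertSum A (k + 1) f) =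
        -pairSum f ((LinearMap.mul K g).compr₂ A) + altThree G := by
      rw [bracketSum_succ_eq, ← sub_eq_neg_add, ← neg_sub, neg_inj]
      change _ = altTwo _ - altTwo (G.compr₂ alternatizeUncurryFinLM)
      rw [← map_sub]
      refine congrArg altTwo (LinearMap.ext₂ fun x y => ?_)
      exact curryLeft_insertSum_succ A k f (x * y)
    have h3 : altThree G = altThree (insertMul A f) := altThree_rotate fun x y z => rfl
    rw [h1, h2, h3]
    abel

/-- `(x, y, z) ↦ f((x * y) * z, …)`. -/
def assocLeft {k : ℕ} (f : g [⋀^Fin (k + 1)]→ₗ[K] N) :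
    g →ₗ[K] g →ₗ[K] g →ₗ[K] g [⋀^Fin k]→ₗ[K] N :=
  (LinearMap.mul K g).compr₂ ((LinearMap.mul K g).compr₂ f.curryLeft)

/-- `(x, y, z) ↦ f(z * (x * y), …)`. -/
def assocRight {k : ℕ} (f : g [⋀^Fin (k + 1)]→ₗ[K] N) :
    g →ₗ[K] g →ₗ[K] g →ₗ[K] g [⋀^Fin k]→ₗ[K] N :=
  (LinearMap.mul K g).compr₂ ((LinearMap.mul K g).compr₂ f.curryLeft).flip

/-- The alternatization of `f((x * y) * z, …) - f(x * (y * z), …)` vanishes, because the associator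
of a pre-Lie algebra is symmetric in its first two arguments. -/
theorem altThree_assocLeft {k : ℕ} (f : g [⋀^Fin (k + 1)]→ₗ[K] N) :
    altThree (assocLeft f) = altThree (assocRight f) := by
  let T : g →ₗ[K] g →ₗ[K] g →ₗ[K] g [⋀^Fin k]→ₗ[K] N :=
    { toFun := fun x => (LinearMap.mul K g).compr₂ (f.curryLeft ∘ₗ LinearMap.mul K g x)
      map_add' := fun x y => by ext; simp
      map_smul' := fun c x => by ext; simp }
  have hT : altThree (assocRight f) = altThree T := altThree_rotate fun _ _ _ => rfl
  rw [hT]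
  refine altThree_eq_of_sub_symmetric fun x y z => ?_
  have h := LeftPreLieRing.assoc_symm x y z
  simp only [associator_apply] at h
  change f.curryLeft (x * y * z) - f.curryLeft (x * (y * z)) =
    f.curryLeft (y * x * z) - f.curryLeft (y * (x * z))
  rw [← map_sub, ← map_sub, h]

/-- The Jacobi identity of the commutator bracket, in the form that the bracket part of the
Chevalley-Eilenberg coboundary squares to zero. -/
theorem bracketSum_bracketSum [CharZero K] (k : ℕ) (f : g [⋀^Fin k]→ₗ[K] N) :
    bracketSum K g N (k + 1) (bracketSum K g N k f) = 0 := by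
  cases k with
  | zero => exact (bracketSum K g N 1).map_zero
  | succ k =>
    have : IsAddTorsionFree N := by
      have := Module.compHom N (algebraMap ℚ K)
      exact .of_module_rat N
    set m := (LinearMap.mul K g).compr₂ f.curryLeft with hm
    -- `c v z` is the contraction with `v` of the cochain `∑ ± f(z * w, …)` alternatized over `w`
    let c : g →ₗ[K] g →ₗ[K] g [⋀^Fin k]→ₗ[K] N :=
      (curryLeftLinearMap ∘ₗ alternatizeUncurryFinLM ∘ₗ m).flip
    have hB : bracketSum K g N (k + 2) (bracketSum K g N (k + 1) f) =
        altThree (assocLeft f) - altThree ((LinearMap.mul K g).compr₂ c) := by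
      rw [bracketSum_succ_eq k, _root_.map_neg, bracketSum_succ_eq, neg_neg]
      change _ = altTwo ((assocLeft f).compr₂ alternatizeUncurryFinLM) -
        altTwo (((LinearMap.mul K g).compr₂ c).compr₂ alternatizeUncurryFinLM)
      rw [← map_sub]
      refine congrArg altTwo (LinearMap.ext₂ fun x y => ?_)
      exact curryLeft_alternatizeUncurryFin_succ _ (x * y)
    rw [hB, altThree_assocLeft, sub_eq_zero]
    cases k with
    | zero =>
      refine congrArg altThree (LinearMap.ext₂ fun x y => LinearMap.ext fun z => ?_)
      exact (curryLeft_alternatizeUncurryFin_zero (m z) (x * y)).symm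
    | succ k =>
      -- `(x, y, z, w) ↦ f(z * w, x * y, …)`
      let F : g →ₗ[K] g →ₗ[K] g →ₗ[K] g →ₗ[K] g [⋀^Fin k]→ₗ[K] N :=
        (LinearMap.mul K g).compr₂
          { toFun := fun v => m.compr₂ (curryLeftLinearMap.flip v)
            map_add' := fun _ _ => by ext; simp
            map_smul' := fun _ _ => by ext; simp }
      have hc : altThree ((LinearMap.mul K g).compr₂ c) = altThree (assocRight f) - altFour F := by
        refine altThree_sub (G := F.compr₂ (alternatizeUncurryFinLM.compRight K)) fun x y z => ?_
        exact curryLeft_alternatizeUncurryFin_succ (m z) (x * y)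
      have hF : altFour F = 0 := altFour_eq_zero fun x y z w =>
        curryLeft_curryLeft_swap f (x * y) (z * w)
      rw [hc, hF, sub_zero]

/-- If `b(x) a(y) + d(x) c(y)`, antisymmetrized in `x` and `y`, is `e([x, y])`, then the composites
of the corresponding insertion operators add up to zero with the bracket terms of `e`. -/
theorem insertSum_comp_add_eq_zero (a : g →ₗ[K] N →ₗ[K] N') (b : g →ₗ[K] N' →ₗ[K] N'')
    (c : g →ₗ[K] N →ₗ[K] M') (d : g →ₗ[K] M' →ₗ[K] N'') (e : g →ₗ[K] N →ₗ[K] N'')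
    (h : ∀ x y n, b x (a y n) - b y (a x n) + (d x (c y n) - d y (c x n)) = e (x * y - y * x) n)
    (k : ℕ) (f : g [⋀^Fin k]→ₗ[K] N) :
    insertSum b (k + 1) (insertSum a k f) + insertSum d (k + 1) (insertSum c k f) +
      (insertSum e (k + 1) (bracketSum K g N k f) +
        bracketSum K g N'' (k + 1) (insertSum e k f)) = 0 := by
  rw [insertSum_insertSum, insertSum_insertSum, insertSum_bracketSum_add, ← map_add,
    ← sub_eq_add_neg, ← map_sub]
  refine pairSum_eq_zero f fun x y => LinearMap.ext fun n => ?_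
  have h' := h x y n
  rw [_root_.map_sub, LinearMap.sub_apply] at h'
  change b x (a y n) + d x (c y n) - e (x * y) n = b y (a x n) + d y (c x n) - e (y * x) n
  rw [sub_eq_sub_iff_add_eq_add]
  rw [← sub_eq_zero] at h' ⊢
  rw [← h']
  abel

/-- The Chevalley-Eilenberg coboundary with coefficients in a Lie algebra representation squares to
zero. -/
theorem insertSum_add_bracketSum_comp_self [CharZero K] (a : g →ₗ[K] N →ₗ[K] N)
    (h : ∀ x y n, a x (a y n) - a y (a x n) = a (x * y - y * x) n)
    (k : ℕ) (f : g [⋀^Fin k]→ₗ[K] N) :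
    (insertSum a (k + 1) + bracketSum K g N (k + 1)) ((insertSum a k + bracketSum K g N k) f) =
      0 := by
  have h0 := insertSum_comp_add_eq_zero a a (0 : g →ₗ[K] N →ₗ[K] N) 0 a
    (fun x y n => by simpa using h x y n) k f
  have h1 : insertSum (0 : g →ₗ[K] N →ₗ[K] N) (k + 1) (insertSum 0 k f) = 0 := by
    ext; simp [insertSum_apply]
  rw [h1, add_zero] at h0
  simp only [LinearMap.add_apply, _root_.map_add, bracketSum_bracketSum, add_zero]
  rw [← h0]
  abel

theorem insertSum_add_left (A B : g →ₗ[K] N →ₗ[K] N') (k : ℕ) (f : g [⋀^Fin k]→ₗ[K] N) :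
    insertSum (A + B) k f = insertSum A k f + insertSum B k f := by
  ext v
  simp [insertSum_apply, Finset.sum_add_distrib]

theorem compLM_insertSum (A : g →ₗ[K] N →ₗ[K] N') (φ : N' →ₗ[K] N'') (k : ℕ)
    (f : g [⋀^Fin k]→ₗ[K] N) :
    compLM φ (k + 1) (insertSum A k f) = insertSum (A.compr₂ φ) k f := by
  ext v
  simp [compLM, insertSum_apply]

theorem insertSum_compLM (A : g →ₗ[K] N' →ₗ[K] N'') (φ : N →ₗ[K] N') (k : ℕ)
    (f : g [⋀^Fin k]→ₗ[K] N) :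
    insertSum A k (compLM φ k f) = insertSum (A.compl₂ φ) k f := by
  ext v
  simp [compLM, insertSum_apply]

theorem compLM_bracketSum (φ : N →ₗ[K] N') (k : ℕ) (f : g [⋀^Fin k]→ₗ[K] N) :
    compLM φ (k + 1) (bracketSum K g N k f) = bracketSum K g N' k (compLM φ k f) := by
  cases k with
  | zero => exact (compLM φ 1).map_zero
  | succ k =>
    ext v
    simp [compLM, bracketSum_apply]

end Cartan

/-! ### Pointwise identities of representations and derivations -/

section Squares

variable {K : Type u} {g : Type v} {V : Type w} [Field K] [LeftPreLieRing g]
  [LeftPreLieAlgebra K g] [AddCommGroup V] [Module K V]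

theorem Rep.rho_bracket_apply (P : Rep K g V) (x y : g) (u : V) :
    P.ρ (x * y - y * x) u = P.ρ x (P.ρ y u) - P.ρ y (P.ρ x u) :=
  LinearMap.congr_fun (P.map_bracket x y) u

theorem Rep.rho_mul_apply (P : Rep K g V) (x y : g) (u : V) :
    P.ρ (x * y) u = P.ρ (y * x) u + (P.ρ x (P.ρ y u) - P.ρ y (P.ρ x u)) := by
  rw [← P.rho_bracket_apply, map_sub, LinearMap.sub_apply, add_sub_cancel]

theorem Rep.mu_mul_apply (P : Rep K g V) (x y : g) (u : V) :
    P.μ (x * y) u = P.μ y (P.μ x u) - P.μ y (P.ρ x u) + P.ρ x (P.μ y u) := by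
  have h := LinearMap.congr_fun (P.compat x y) u
  simp only [LinearMap.sub_apply, LinearMap.comp_apply] at h
  grind

theorem Rep.actHom_apply (P : Rep K g V) (x : g) (φ : g →ₗ[K] V) (y : g) :
    P.actHom x φ y = P.ρ x (φ y) + P.μ y (φ x) - φ (x * y) := rfl

theorem Rep.actRho_apply (P : Rep K g V) (x : g) (φ : V →ₗ[K] V) (u : V) :
    P.actRho x φ u = P.ρ x (φ u) - φ (P.ρ x u) := rfl

theorem Rep.actMu_apply (P : Rep K g V) (x : g) (φ : V →ₗ[K] g →ₗ[K] V) (u : V) (y : g) :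
    P.actMu x φ u y = -φ u (x * y) + P.ρ x (φ u y) - φ (P.ρ x u) y + P.μ y (φ u x)
      + φ (P.μ x u) y := rfl

theorem Rep.muBase_apply (P : Rep K g V) (φ : g →ₗ[K] g) (ψ : V →ₗ[K] V) (u : V) (y : g) :
    P.muBase (φ, ψ) u y = P.μ (φ y) u + P.μ y (ψ u) - ψ (P.μ y u) := rfl

/-- `Hom(g, V)` is a representation of the sub-adjacent Lie algebra. -/
theorem Rep.actHom_bracket (P : Rep K g V) (x y : g) (φ : g →ₗ[K] V) :
    P.actHom x (P.actHom y φ) - P.actHom y (P.actHom x φ) = P.actHom (x * y - y * x) φ := by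
  ext z
  have h := LeftPreLieRing.assoc_symm x y z
  simp only [associator_apply] at h
  have h' := congrArg φ h
  simp only [map_sub] at h'
  simp only [LinearMap.sub_apply, P.actHom_apply, P.rho_mul_apply x y, map_add, map_sub,
    P.mu_mul_apply]
  grind

/-- `Hom(V, V)` is a representation of the sub-adjacent Lie algebra. -/
theorem Rep.actRho_bracket (P : Rep K g V) (x y : g) (φ : V →ₗ[K] V) :
    P.actRho x (P.actRho y φ) - P.actRho y (P.actRho x φ) = P.actRho (x * y - y * x) φ := by
  ext u
  simp only [LinearMap.sub_apply, P.actRho_apply, P.rho_mul_apply x y, map_sub, map_add]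
  abel

/-- `Hom(V ⊗ g, V)` is a representation of the sub-adjacent Lie algebra. -/
theorem Rep.actMu_bracket (P : Rep K g V) (x y : g) (φ : V →ₗ[K] g →ₗ[K] V) :
    P.actMu x (P.actMu y φ) - P.actMu y (P.actMu x φ) = P.actMu (x * y - y * x) φ := by
  ext u z
  have h := LeftPreLieRing.assoc_symm x y z
  simp only [associator_apply] at h
  have h' := congrArg (φ u) h
  simp only [map_sub] at h'
  simp only [LinearMap.sub_apply, P.actMu_apply, P.rho_mul_apply x y, map_add, map_sub, map_neg,
    P.mu_mul_apply, LinearMap.add_apply]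
  grind

/-- Together with `Rep.actHom_bracket` and `Rep.actRho_bracket`: the triangular action on
`Hom(g, g) ⊕ Hom(V, V)` is a representation of the sub-adjacent Lie algebra. -/
theorem Rep.rhoIns_bracket (P : Rep K g V) (x y : g) (φ : g →ₗ[K] g) :
    P.rhoIns x ((Rep.regular K g).actHom y φ) - P.rhoIns y ((Rep.regular K g).actHom x φ) +
      (P.actRho x (P.rhoIns y φ) - P.actRho y (P.rhoIns x φ)) = P.rhoIns (x * y - y * x) φ := by
  ext u
  have h1 := P.rho_bracket_apply x (φ y) u
  have h2 := P.rho_bracket_apply y (φ x) u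
  change P.ρ (y * φ x + φ y * x - φ (y * x)) u - P.ρ (x * φ y + φ x * y - φ (x * y)) u +
    ((P.ρ x (P.ρ (φ y) u) - P.ρ (φ y) (P.ρ x u)) - (P.ρ y (P.ρ (φ x) u) - P.ρ (φ x) (P.ρ y u))) =
      P.ρ (φ (x * y - y * x)) u
  simp only [map_sub, map_add, LinearMap.sub_apply, LinearMap.add_apply] at h1 h2 ⊢
  grind

/-- The map `Rep.muBase` is equivariant: the component on `Hom(g, g)`. -/
theorem Rep.muBase_actHom (P : Rep K g V) (x : g) (φ : g →ₗ[K] g) :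
    P.muBase ((Rep.regular K g).actHom x φ, P.rhoIns x φ) = P.actMu x (P.muBase (φ, 0)) := by
  ext u y
  rw [P.muBase_apply, P.actMu_apply]
  change P.μ (x * φ y + φ x * y - φ (x * y)) u + P.μ y (P.ρ (φ x) u) - P.ρ (φ x) (P.μ y u) = _
  simp only [P.muBase_apply, map_sub, map_add, LinearMap.sub_apply, LinearMap.add_apply,
    P.mu_mul_apply, LinearMap.zero_apply, map_zero]
  abel

/-- The map `Rep.muBase` is equivariant: the component on `Hom(V, V)`. -/
theorem Rep.muBase_actRho (P : Rep K g V) (x : g) (ψ : V →ₗ[K] V) :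
    P.muBase (0, P.actRho x ψ) = P.actMu x (P.muBase (0, ψ)) := by
  ext u y
  simp only [P.muBase_apply, P.actMu_apply, P.actRho_apply, LinearMap.zero_apply, map_zero,
    P.mu_mul_apply, map_sub, map_add]
  abel

theorem Pair.insD_apply (P : Pair K g V) (x : g) (φ : V →ₗ[K] g →ₗ[K] V) (y : g) :
    P.insD x φ y = φ (P.D x) y := rfl

/-- The insertion of `D` into cochains with values in `Hom(V ⊗ g, V)` satisfies the hypothesis of
`insertSum_comp_add_eq_zero`. This is the relation `dδ + δ∂ = 0` on `f_μ`. -/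
theorem Pair.insD_bracket (P : Pair K g V) (x y : g) (φ : V →ₗ[K] g →ₗ[K] V) :
    P.actHom x (P.insD y φ) - P.actHom y (P.insD x φ) +
      (P.insD x (P.actMu y φ) - P.insD y (P.actMu x φ)) = P.insD (x * y - y * x) φ := by
  ext z
  simp only [LinearMap.sub_apply, LinearMap.add_apply, P.actHom_apply, P.insD_apply, P.actMu_apply,
    map_sub, P.leibniz, map_add]
  abel

/-- The relation behind `dδ + δ∂ = 0` on `f_g`: the failure of `φ ↦ D ∘ φ` to be equivariant is
compensated by the contributions of `f_g` to `(∂f)_ρ` and `(∂f)_μ`. -/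
theorem Pair.postD_actHom (P : Pair K g V) (x : g) (φ : g →ₗ[K] g) :
    P.actHom x (P.postD φ) + P.insD x (P.muBase (φ, 0)) + P.preD (P.rhoIns x φ) =
      P.postD ((Rep.regular K g).actHom x φ) := by
  ext y
  change P.ρ x (P.D (φ y)) + P.μ y (P.D (φ x)) - P.D (φ (x * y)) + P.muBase (φ, 0) (P.D x) y +
    P.ρ (φ x) (P.D y) = P.D (x * φ y + φ x * y - φ (x * y))
  simp only [P.muBase_apply, P.leibniz, map_add, map_sub, LinearMap.zero_apply, map_zero]
  abel

/-- The relation behind `dδ + δ∂ = 0` on `f_ρ`: the failure of `ψ ↦ ψ ∘ D` to be equivariant is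
compensated by the contribution of `f_ρ` to `(∂f)_μ`. -/
theorem Pair.preD_actRho (P : Pair K g V) (x : g) (ψ : V →ₗ[K] V) :
    P.preD (P.actRho x ψ) + P.insD x (P.muBase (0, ψ)) = P.actHom x (P.preD ψ) := by
  ext y
  change P.ρ x (ψ (P.D y)) - ψ (P.ρ x (P.D y)) + P.muBase (0, ψ) (P.D x) y =
    P.ρ x (ψ (P.D y)) + P.μ y (ψ (P.D x)) - ψ (P.D (x * y))
  simp only [P.muBase_apply, P.leibniz, map_add, LinearMap.zero_apply, map_zero]
  abel

end Squares

/-! ### The coboundary operators square to zero and anticommute with `δ` -/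

section Anticommutation

variable {K : Type u} {g : Type v} {V : Type w} [Field K] [LeftPreLieRing g]
  [LeftPreLieAlgebra K g] [AddCommGroup V] [Module K V]

theorem Rep.partialMuBase_eq (P : Rep K g V) (k : ℕ) (f : g [⋀^Fin k]→ₗ[K] (g →ₗ[K] g))
    (r : g [⋀^Fin k]→ₗ[K] (V →ₗ[K] V)) :
    P.partialMuBase k (f, r) = (-1 : ℤ) ^ k •
      (compLM (P.muBase ∘ₗ LinearMap.inl K (g →ₗ[K] g) (V →ₗ[K] V)) k f +
        compLM (P.muBase ∘ₗ LinearMap.inr K (g →ₗ[K] g) (V →ₗ[K] V)) k r) := rfl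

theorem Pair.deltaBase_eq (P : Pair K g V) (k : ℕ) (f : g [⋀^Fin k]→ₗ[K] (g →ₗ[K] g))
    (r : g [⋀^Fin k]→ₗ[K] (V →ₗ[K] V)) :
    P.deltaBase k (f, r) = (-1 : ℤ) ^ (k + 1) • (-compLM P.postD k f + compLM P.preD k r) := rfl

/-- The part of `(∂∂f)_μ` depending on `f_g` and `f_ρ` vanishes: composition with the equivariant
map `Rep.muBase` commutes with the coboundaries, and the sign `(-1)^k` changes with the degree. -/
theorem Rep.partialMuBase_add_partialMuMu (P : Rep K g V) (k : ℕ)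
    (f : g [⋀^Fin k]→ₗ[K] (g →ₗ[K] g)) (r : g [⋀^Fin k]→ₗ[K] (V →ₗ[K] V)) :
    P.partialMuBase (k + 1) ((Rep.regular K g).dHom k f, P.partialRho k (f, r)) +
      P.partialMuMu (k + 1) (P.partialMuBase k (f, r)) = 0 := by
  set C₁ := P.muBase ∘ₗ LinearMap.inl K (g →ₗ[K] g) (V →ₗ[K] V) with hC₁
  set C₂ := P.muBase ∘ₗ LinearMap.inr K (g →ₗ[K] g) (V →ₗ[K] V) with hC₂
  have h₁ : insertSum ((Rep.regular K g).actHom.compr₂ C₁) k f +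
      insertSum (P.rhoIns.compr₂ C₂) k f = insertSum (P.actMu.compl₂ C₁) k f := by
    rw [← insertSum_add_left]
    refine congrArg (fun A => insertSum A k f) (LinearMap.ext₂ fun x φ => ?_)
    refine Eq.trans ?_ (P.muBase_actHom x φ)
    change P.muBase _ + P.muBase _ = _
    rw [← map_add]
    simp
  have h₂ : P.actRho.compr₂ C₂ = P.actMu.compl₂ C₂ := LinearMap.ext₂ P.muBase_actRho
  have h₃ : (insertSum P.actMu k + bracketSum K g (V →ₗ[K] g →ₗ[K] V) k)
      (P.partialMuBase k (f, r)) =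
      (-1 : ℤ) ^ k • ((insertSum (P.actMu.compl₂ C₁) k f + bracketSum K g _ k (compLM C₁ k f)) +
        (insertSum (P.actMu.compl₂ C₂) k r + bracketSum K g _ k (compLM C₂ k r))) := by
    rw [P.partialMuBase_eq, map_zsmul, map_add, LinearMap.add_apply, LinearMap.add_apply,
      insertSum_compLM, insertSum_compLM]
  refine (congrArg₂ (· + ·) (P.partialMuBase_eq (k + 1) _ _) h₃).trans ?_
  simp only [Rep.partialRho, Rep.dHom, LinearMap.coprod_apply,
    LinearMap.add_apply, map_add, compLM_bracketSum, compLM_insertSum,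
    ← hC₁, ← hC₂, ← h₁, h₂, pow_succ]
  rcases neg_one_pow_eq_or ℤ k with hk | hk <;> rw [hk] <;> abel

/-- The part of `dδf + δ∂f` depending on `f_μ` vanishes. -/
theorem Pair.dHom_deltaMu (P : Pair K g V) (k : ℕ) (m : AltPred K g (V →ₗ[K] g →ₗ[K] V) k) :
    P.dHom k (P.deltaMu k m) + P.deltaMu (k + 1) (P.partialMuMu k m) = 0 := by
  cases k with
  | zero =>
    change P.dHom 0 0 + P.deltaMu 1 0 = 0
    exact (congrArg₂ (· + ·) (map_zero (P.dHom 0)) (map_zero (P.deltaMu 1))).trans (add_zero _)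
  | succ k =>
    have key (m : g [⋀^Fin k]→ₗ[K] (V →ₗ[K] g →ₗ[K] V)) :
        P.dHom (k + 1) (insertSum P.insD k m) + insertSum P.insD (k + 1)
          ((insertSum P.actMu k + bracketSum K g (V →ₗ[K] g →ₗ[K] V) k) m) = 0 := by
      rw [Rep.dHom, LinearMap.add_apply, LinearMap.add_apply, map_add,
        ← insertSum_comp_add_eq_zero _ _ _ _ _ P.insD_bracket k m]
      abel
    exact key m

/-- The part of `dδf + δ∂f` depending on `f_g` and `f_ρ` vanishes. -/
theorem Pair.dHom_deltaBase (P : Pair K g V) (k : ℕ) (f : g [⋀^Fin k]→ₗ[K] (g →ₗ[K] g))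
    (r : g [⋀^Fin k]→ₗ[K] (V →ₗ[K] V)) :
    P.dHom k (P.deltaBase k (f, r)) + P.deltaMu (k + 1) (P.partialMuBase k (f, r)) +
      P.deltaBase (k + 1) ((Rep.regular K g).dHom k f, P.partialRho k (f, r)) = 0 := by
  set C₁ := P.muBase ∘ₗ LinearMap.inl K (g →ₗ[K] g) (V →ₗ[K] V) with hC₁
  set C₂ := P.muBase ∘ₗ LinearMap.inr K (g →ₗ[K] g) (V →ₗ[K] V) with hC₂
  have h₁ : insertSum (P.actHom.compl₂ P.postD) k f + insertSum (P.insD.compl₂ C₁) k f +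
      insertSum (P.rhoIns.compr₂ P.preD) k f =
        insertSum ((Rep.regular K g).actHom.compr₂ P.postD) k f := by
    rw [← insertSum_add_left, ← insertSum_add_left]
    exact congrArg (fun A => insertSum A k f) (LinearMap.ext₂ P.postD_actHom)
  have h₂ : insertSum (P.actRho.compr₂ P.preD) k r + insertSum (P.insD.compl₂ C₂) k r =
      insertSum (P.actHom.compl₂ P.preD) k r := by
    rw [← insertSum_add_left]
    exact congrArg (fun A => insertSum A k r) (LinearMap.ext₂ P.preD_actRho)
  have h₃ : P.deltaMu (k + 1) (P.partialMuBase k (f, r)) =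
      (-1 : ℤ) ^ k • (insertSum (P.insD.compl₂ C₁) k f + insertSum (P.insD.compl₂ C₂) k r) := by
    rw [← insertSum_compLM, ← insertSum_compLM, ← map_add, ← map_zsmul]
    rfl
  rw [h₃, P.deltaBase_eq, P.deltaBase_eq, map_zsmul]
  simp only [Rep.partialRho, Rep.dHom, LinearMap.coprod_apply, LinearMap.add_apply,
    map_add, map_neg, compLM_bracketSum,
    compLM_insertSum, insertSum_compLM, ← h₁, ← h₂, pow_succ]
  rcases neg_one_pow_eq_or ℤ k with hk | hk <;> rw [hk] <;> abel

/-- `δ` anticommutes with the coboundary operators. -/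
theorem Pair.dShift_delta_add (P : Pair K g V) (n : ℕ) (f : CRep K g V n) :
    P.dShift (n + 1) (P.delta n f) + P.delta (n + 1) (P.partialD n f) = 0 := by
  cases n with
  | zero =>
    change P.dShift 1 0 + P.delta 1 0 = 0
    rw [map_zero, map_zero, add_zero]
  | succ k =>
    obtain ⟨f, r, m⟩ := f
    have h₁ := P.dHom_deltaMu k m
    have h₂ := P.dHom_deltaBase k f r
    change P.dHom k (P.deltaMu k m + P.deltaBase k (f, r)) +
      (P.deltaMu (k + 1) (P.partialMuBase k (f, r) + P.partialMuMu k m) +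
        P.deltaBase (k + 1) ((Rep.regular K g).dHom k f, P.partialRho k (f, r))) = 0
    erw [map_add, map_add]
    rw [← add_zero (0 : g [⋀^Fin (k + 1)]→ₗ[K] (g →ₗ[K] V))]
    nth_rewrite 1 [← h₁]
    rw [← h₂]
    abel

end Anticommutation

section SquareZero

variable {K : Type u} {g : Type v} {V : Type w} [Field K] [CharZero K] [LeftPreLieRing g]
  [LeftPreLieAlgebra K g] [AddCommGroup V] [Module K V]

theorem Rep.dHom_dHom (P : Rep K g V) (k : ℕ) (f : g [⋀^Fin k]→ₗ[K] (g →ₗ[K] V)) :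
    P.dHom (k + 1) (P.dHom k f) = 0 :=
  insertSum_add_bracketSum_comp_self P.actHom P.actHom_bracket k f

theorem Rep.partialRho_partialRho (P : Rep K g V) (k : ℕ) (f : g [⋀^Fin k]→ₗ[K] (g →ₗ[K] g))
    (r : g [⋀^Fin k]→ₗ[K] (V →ₗ[K] V)) :
    P.partialRho (k + 1) ((Rep.regular K g).dHom k f, P.partialRho k (f, r)) = 0 := by
  have h₁ := insertSum_comp_add_eq_zero _ _ _ _ _ P.rhoIns_bracket k f
  have h₂ := insertSum_add_bracketSum_comp_self P.actRho P.actRho_bracket k r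
  simp only [LinearMap.add_apply, map_add] at h₂
  simp only [Rep.partialRho, Rep.dHom, LinearMap.coprod_apply, LinearMap.add_apply, map_add]
  rw [← add_zero (0 : g [⋀^Fin (k + 1 + 1)]→ₗ[K] (V →ₗ[K] V))]
  nth_rewrite 1 [← h₁]
  rw [← h₂]
  abel

theorem Rep.partialMuMu_partialMuMu (P : Rep K g V) (k : ℕ)
    (m : AltPred K g (V →ₗ[K] g →ₗ[K] V) k) :
    P.partialMuMu (k + 1) (P.partialMuMu k m) = 0 := by
  cases k with
  | zero => exact map_zero (P.partialMuMu 1)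
  | succ k => exact insertSum_add_bracketSum_comp_self P.actMu P.actMu_bracket k m

theorem Rep.partialD_comp_partialD (P : Rep K g V) (n : ℕ) :
    P.partialD (n + 1) ∘ₗ P.partialD n = 0 := by
  cases n with
  | zero => exact LinearMap.comp_zero _
  | succ k =>
    refine LinearMap.ext fun f => ?_
    obtain ⟨f, r, m⟩ := f
    refine Prod.ext ((Rep.regular K g).dHom_dHom k f)
      (Prod.ext (P.partialRho_partialRho k f r) ?_)
    change P.partialMuBase (k + 1) ((Rep.regular K g).dHom k f, P.partialRho k (f, r)) +
      P.partialMuMu (k + 1) (P.partialMuBase k (f, r) + P.partialMuMu k m) = 0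
    have h := P.partialMuBase_add_partialMuMu k f r
    have h' := P.partialMuMu_partialMuMu k m
    erw [map_add, h', add_zero]
    exact h

theorem Rep.dShift_comp_dShift (P : Rep K g V) (n : ℕ) :
    P.dShift (n + 1) ∘ₗ P.dShift n = 0 := by
  match n with
  | 0 => exact LinearMap.comp_zero _
  | 1 => exact LinearMap.comp_zero _
  | k + 2 => exact LinearMap.ext (P.dHom_dHom k)

theorem Pair.pairD_comp_pairD (P : Pair K g V) (n : ℕ) :
    P.pairD (n + 1) ∘ₗ P.pairD n = 0 := by
  refine LinearMap.ext fun x => ?_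
  obtain ⟨f, θ⟩ := x
  refine Prod.ext (LinearMap.congr_fun (P.partialD_comp_partialD n) f) ?_
  change P.dShift (n + 1) (P.dShift n θ + P.delta n f) + P.delta (n + 1) (P.partialD n f) = 0
  have h := LinearMap.congr_fun (P.dShift_comp_dShift n) θ
  simp only [LinearMap.comp_apply, LinearMap.zero_apply] at h
  rw [map_add, h, zero_add, P.dShift_delta_add]

end SquareZero

/-! ### Morphisms of complexes and the exact sequences -/

section Complexes

variable {K : Type u} [Field K] {X Y : ℕ → Type w} [∀ n, AddCommGroup (X n)]
  [∀ n, Module K (X n)] [∀ n, AddCommGroup (Y n)] [∀ n, Module K (Y n)]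
  {dX : ∀ n, X n →ₗ[K] X (n + 1)} {dY : ∀ n, Y n →ₗ[K] Y (n + 1)}

/-- The morphism of complexes given by linear maps commuting with the differentials. -/
noncomputable def complexHom (hX : ∀ n, dX (n + 1) ∘ₗ dX n = 0) (hY : ∀ n, dY (n + 1) ∘ₗ dY n = 0)
    (f : ∀ n, X n →ₗ[K] Y n) (hf : ∀ n, dY n ∘ₗ f n = f (n + 1) ∘ₗ dX n) :
    complexOf X dX hX ⟶ complexOf Y dY hY :=
  CochainComplex.ofHom (fun n => ModuleCat.ofHom (f n)) (fun n => by
    change ModuleCat.ofHom (f n) ≫ (complexOf Y dY hY).d n (n + 1) =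
      (complexOf X dX hX).d n (n + 1) ≫ ModuleCat.ofHom (f (n + 1))
    rw [complexOf_d, complexOf_d]
    exact ModuleCat.hom_ext (hf n))

end Complexes
end PreLieDer

theorem mainTheorem4 {K : Type*} {g : Type*} {V : Type*} [Field K] [IsAlgClosed K] [CharZero K]
    [LeftPreLieRing g] [LeftPreLieAlgebra K g] [AddCommGroup V] [Module K V]
    (P : PreLieDer.Pair K g V) :
    ∃ (hd : ∀ n, P.dShift (n + 1) ∘ₗ P.dShift n = 0)
      (hD : ∀ n, P.pairD (n + 1) ∘ₗ P.pairD n = 0)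
      (hp : ∀ n, P.partialD (n + 1) ∘ₗ P.partialD n = 0)
      (ι : PreLieDer.complexOf (PreLieDer.CVShift K g V) P.dShift hd ⟶
        PreLieDer.complexOf (PreLieDer.CPair K g V) P.pairD hD)
      (p : PreLieDer.complexOf (PreLieDer.CPair K g V) P.pairD hD ⟶
        PreLieDer.complexOf (PreLieDer.CRep K g V) P.partialD hp)
      (w : ι ≫ p = 0)
      (hS : (ShortComplex.mk ι p w).ShortExact),
      (∀ (n : ℕ) (θ : PreLieDer.CVShift K g V n), (ι.f n).hom θ = ((0, θ) : PreLieDer.CPair K g V n)) ∧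
      (∀ (n : ℕ) (x : PreLieDer.CPair K g V n), (p.f n).hom x = x.1) ∧
      (Function.Injective (HomologicalComplex.homologyMap ι 0).hom) ∧
      (∀ n : ℕ, Function.Exact (HomologicalComplex.homologyMap ι n).hom
        (HomologicalComplex.homologyMap p n).hom) ∧
      (∀ n : ℕ, Function.Exact (HomologicalComplex.homologyMap p n).hom
        (hS.δ n (n + 1) rfl).hom) ∧
      (∀ n : ℕ, Function.Exact (hS.δ n (n + 1) rfl).hom
        (HomologicalComplex.homologyMap ι (n + 1)).hom) ∧
      (∀ (n : ℕ) (α : PreLieDer.CRep K g V n) (hα : P.partialD n α = 0),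
        ∃ hδ : P.dShift (n + 1) (P.delta n α) = 0,
          (hS.δ n (n + 1) rfl).hom
              (PreLieDer.cohClass (PreLieDer.CRep K g V) P.partialD hp n α hα) =
            PreLieDer.cohClass (PreLieDer.CVShift K g V) P.dShift hd (n + 1) (P.delta n α) hδ) := by
  have hd := P.dShift_comp_dShift
  have hD := P.pairD_comp_pairD
  have hp := P.partialD_comp_partialD
  let ι := PreLieDer.complexHom hd hD (fun n => LinearMap.inr K (PreLieDer.CRep K g V n)
    (PreLieDer.CVShift K g V n)) (fun n => LinearMap.ext fun θ => by
      refine Prod.ext (map_zero (P.partialD n)) ?_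
      change P.dShift n θ + P.delta n 0 = P.dShift n θ
      rw [map_zero, add_zero])
  let p := PreLieDer.complexHom hD hp (fun n => LinearMap.fst K (PreLieDer.CRep K g V n)
    (PreLieDer.CVShift K g V n)) (fun n => rfl)
  have w : ι ≫ p = 0 := by
    ext n x
    rfl
  have hS : (ShortComplex.mk ι p w).ShortExact := by
    refine HomologicalComplex.shortExact_of_degreewise_shortExact _ fun n => ?_
    refine ShortComplex.ShortExact.mk' ?_ ?_ ?_
    · rw [ShortComplex.moduleCat_exact_iff]
      rintro ⟨f, θ⟩ (hf : f = 0)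
      exact ⟨θ, Prod.ext hf.symm rfl⟩
    · exact (ModuleCat.mono_iff_injective (ModuleCat.ofHom (LinearMap.inr K
        (PreLieDer.CRep K g V n) (PreLieDer.CVShift K g V n)))).mpr LinearMap.inr_injective
    · exact (ModuleCat.epi_iff_surjective (ModuleCat.ofHom (LinearMap.fst K
        (PreLieDer.CRep K g V n) (PreLieDer.CVShift K g V n)))).mpr LinearMap.fst_surjective
  refine ⟨hd, hD, hp, ι, p, w, hS, fun n θ => rfl, fun n x => rfl, ?_, fun n => ?_, fun n => ?_,
    fun n => ?_, fun n α hα => ?_⟩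
  -- the shifted complex vanishes in degree `0`, and so does its cohomology
  · have hX : Limits.IsZero ((PreLieDer.complexOf (PreLieDer.CVShift K g V) P.dShift hd).X 0) :=
      ModuleCat.isZero_of_subsingleton (ModuleCat.of K PUnit)
    have := (ShortComplex.isZero_homology_of_isZero_X₂
      ((PreLieDer.complexOf (PreLieDer.CVShift K g V) P.dShift hd).sc 0) hX).mono
        (HomologicalComplex.homologyMap ι 0)
    exact (ModuleCat.mono_iff_injective _).mp this
  · exact (ShortComplex.ShortExact.moduleCat_exact_iff_function_exact _).mp (hS.homology_exact₂ n)
  · exact (ShortComplex.ShortExact.moduleCat_exact_iff_function_exact _).mp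
      (hS.homology_exact₃ n (n + 1) rfl)
  · exact (ShortComplex.ShortExact.moduleCat_exact_iff_function_exact _).mp
      (hS.homology_exact₁ n (n + 1) rfl)
  -- the cochain `(α, 0)` lifts `α`, and its coboundary `(0, δα)` is the image of `δα`
  · have hδ : P.dShift (n + 1) (P.delta n α) = 0 := by
      have h := P.dShift_delta_add n α
      rwa [hα, map_zero, add_zero] at h
    refine ⟨hδ, ?_⟩
    refine hS.δ_apply n (n + 1) rfl α ?_ ((α, 0) : PreLieDer.CPair K g V n) rfl (P.delta n α) ?_
      (n + 2) (by simp)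
    change ((0, P.delta n α) : PreLieDer.CPair K g V (n + 1)) =
      ((PreLieDer.complexOf (PreLieDer.CPair K g V) P.pairD hD).d n (n + 1)).hom
        ((α, 0) : PreLieDer.CPair K g V n)
    rw [PreLieDer.complexOf_d]
    refine Prod.ext hα.symm ?_
    change P.delta n α = P.dShift n 0 + P.delta n α
    rw [map_zero, zero_add]
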